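/- Let $k\ge 2$ be an integer and let $X$ be a real random variable with distribution $F$. When the moments exist, put $\mu=\mathbb{E}(X)$, $\mu_j=\mathbb{E}(X-\mu)^j$ for $j\ge 0$ and $\sigma^2=\mu_2$. For independent observations $X_1,X_2,\ldots$ from $F$ let $$\bar X_n=\frac1n\sum_{i=1}^n X_i,\qquad M_{k,n}=\frac1n\sum_{i=1}^n (X_i-\bar X_n)^k .$$ The distribution $F$ is called singular of order $k$ if it is non-degenerate (its support contains at least two points), $\mathbb{E}|X|^{2k}<\infty$, and $\sqrt n\,(M_{k,n}-\mu_k)\to 0$ in probability as $n\to\infty$. **Theorem.** If $F$ is singular of order $k\ge 2$, then, as $n\to\infty$, $$n(M_{k,n}-\mu_k)\ \xrightarrow{\ d\ }\ \tfrac12 k(k-1)\mu_{k-2}W_1^2-k\,W_1W_{k-1},$$ where $$\begin{pmatrix}W_1\\ W_{k-1}\end{pmatrix}\sim N_2\left(\begin{pmatrix}0\\0\end{pmatrix},\begin{pmatrix}\sigma^2&\mu_k\\ \mu_k&\mu_{2k-2}-\mu_{k-1}^2\end{pmatrix}\right),$$ the matrix on the right being positive semidefinite (so that this normal distribution, possibly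 degenerate, exists). -/

import Mathlib

open MeasureTheory ProbabilityTheory Filter Topology
open scoped ENNReal

/-- The sample mean `X̄ₙ = n⁻¹ ∑ᵢ xᵢ` of the first `n` terms of a sequence of observations. -/
noncomputable def sampleMean (n : ℕ) (x : ℕ → ℝ) : ℝ :=
  (∑ i ∈ Finset.range n, x i) / n

/-- The sample central moment `M_{k,n} = n⁻¹ ∑ᵢ (xᵢ - X̄ₙ)ᵏ` of the first `n` terms of a
sequence of observations. -/
noncomputable def sampleCentralMoment (k n : ℕ) (x : ℕ → ℝ) : ℝ :=
  (∑ i ∈ Finset.range n, (x i - sampleMean n x) ^ k) / n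

/-- The central moment `μ_j = E (X - E X) ^ j` of a probability distribution `ν` on the line. -/
noncomputable def popCentralMoment (ν : Measure ℝ) (j : ℕ) : ℝ :=
  centralMoment id j ν

/-- A distribution `ν` on the line is singular of order `k` if it is non-degenerate (it has at
least two points of increase), `E |X| ^ (2 k) < ∞`, and `√n (M_{k,n} - μ_k)` tends to `0` in
probability, where `M_{k,n}` is computed from an infinite sample of independent observations
from `ν`, realised here as the coordinates of the infinite product space. -/
structure IsSingularOfOrder (k : ℕ) (ν : Measure ℝ) [IsProbabilityMeasure ν] : Prop where
  nondegenerate : ν.support.Nontrivial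
  integrable : Integrable (fun x : ℝ => |x| ^ (2 * k)) ν
  tendsto : TendstoInMeasure (Measure.infinitePi (fun _ : ℕ => ν))
    (fun (n : ℕ) (x : ℕ → ℝ) => √(n : ℝ) * (sampleCentralMoment k n x - popCentralMoment ν k))
    atTop (fun _ => 0)

/-- The covariance matrix of `(W₁, W_{k-1})`. -/
noncomputable def limitCov (k : ℕ) (ν : Measure ℝ) : Matrix (Fin 2) (Fin 2) ℝ :=
  !![Var[id; ν], popCentralMoment ν k;
     popCentralMoment ν k, popCentralMoment ν (2 * k - 2) - popCentralMoment ν (k - 1) ^ 2]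

/-! Binomial expansion about `μ` gives an exact identity (`sampleCentralMoment_expansion`): `n
(M_{k,n} - μ_k)` is the sum of the influence function over the sample plus a second order term. The
latter is a quadratic expression in the normalised sums of `x - μ` and `(x - μ) ^ (k - 1) -
μ_{k-1}`, with a coefficient converging almost surely. The bivariate CLT and Slutsky's theorem give
its limit, for any `F` with `2 k` moments.

Singularity kills the first sum (`IsSingularOfOrder.influence_ae_eq_zero`): divided by `√n`, it
tends to `0`, yet by the CLT it is asymptotically normal with the variance of the influence
function. That variance is therefore `0`, and only the second order term remains. -/

/-! ### General limit theorems for independent observations. -/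

theorem charFun_map_eq_charFun_map_inner {E Ω : Type*} [NormedAddCommGroup E]
    [InnerProductSpace ℝ E] [MeasurableSpace E] [BorelSpace E] [SecondCountableTopology E]
    {mΩ : MeasurableSpace Ω} {P : Measure Ω} {Y : Ω → E} (hY : AEMeasurable Y P) (t : E) :
    charFun (P.map Y) t = charFun (P.map fun ω => inner ℝ (Y ω) t) 1 := by
  rw [charFun_apply, charFun_apply, integral_map hY (by fun_prop),
    integral_map (by fun_prop) (by fun_prop)]
  simp

/-- The **Cramér–Wold device**. -/
theorem tendstoInDistribution_of_forall_inner {E Ω Ω' : Type*} [NormedAddCommGroup E]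
    [InnerProductSpace ℝ E] [FiniteDimensional ℝ E] [MeasurableSpace E] [BorelSpace E]
    {mΩ : MeasurableSpace Ω} {mΩ' : MeasurableSpace Ω'}
    {P : Measure Ω} [IsProbabilityMeasure P] {P' : Measure Ω'} [IsProbabilityMeasure P']
    {X : ℕ → Ω → E} {Z : Ω' → E} (hX : ∀ n, AEMeasurable (X n) P) (hZ : AEMeasurable Z P')
    (h : ∀ t : E, TendstoInDistribution (fun n ω => inner ℝ (X n ω) t) atTop
      (fun ω => inner ℝ (Z ω) t) (fun _ => P) P') :
    TendstoInDistribution X atTop Z (fun _ => P) P' where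
  forall_aemeasurable := hX
  aemeasurable_limit := hZ
  tendsto := by
    refine ProbabilityMeasure.tendsto_iff_tendsto_charFun.2 fun t => ?_
    have h1 := ProbabilityMeasure.tendsto_iff_tendsto_charFun.1 (h t).tendsto 1
    simp only [ProbabilityMeasure.coe_mk] at h1 ⊢
    rw [charFun_map_eq_charFun_map_inner hZ]
    simpa only [charFun_map_eq_charFun_map_inner (hX _)] using h1

/-- The one-dimensional central limit theorem for a centred square integrable function of
independent observations. -/
theorem tendstoInDistribution_inv_sqrt_mul_sum_comp {E Ω Ω' : Type*} {mE : MeasurableSpace E}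
    {mΩ : MeasurableSpace Ω} {mΩ' : MeasurableSpace Ω'}
    {P : Measure Ω} [IsProbabilityMeasure P] {P' : Measure Ω'} [IsProbabilityMeasure P']
    {ν : Measure E} {X : ℕ → Ω → E} (hlaw : ∀ i, HasLaw (X i) ν P) (hindep : iIndepFun X P)
    {f : E → ℝ} (hf : Measurable f) (hf2 : MemLp f 2 ν) (hf0 : ∫ x, f x ∂ν = 0)
    {Z : Ω' → ℝ} (hZ : HasLaw Z (gaussianReal 0 Var[f; ν].toNNReal) P') :
    TendstoInDistribution (fun (n : ℕ) ω => (√(n : ℝ))⁻¹ * ∑ i ∈ Finset.range n, f (X i ω))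
      atTop Z (fun _ => P) P' := by
  have hmap := (hlaw 0).map_eq
  have hX := (hlaw 0).aemeasurable
  have h0 : P[fun ω => f (X 0 ω)] = 0 := by
    rw [← hf0, ← hmap, integral_map hX hf.aestronglyMeasurable]
  have hident (i : ℕ) : IdentDistrib (X i) (X 0) P P :=
    ⟨(hlaw i).aemeasurable, hX, (hlaw i).map_eq.trans hmap.symm⟩
  have hvar : Var[fun ω => f (X 0 ω); P] = Var[f; ν] := by
    rw [← hmap, variance_map hf.aemeasurable hX]; rfl
  have := tendstoInDistribution_inv_sqrt_mul_sum_sub (X := fun i ω => f (X i ω)) (P := P)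
    (by rwa [hvar]) ((hmap ▸ hf2).comp_of_map hX) (hindep.comp (fun _ => f) fun _ => hf)
    (fun i => (hident i).comp hf)
  simpa [h0] using this

/-- The strong law of large numbers for a function of independent observations. -/
theorem ae_tendsto_sum_comp_div {E Ω : Type*} {mE : MeasurableSpace E}
    {mΩ : MeasurableSpace Ω} {P : Measure Ω} {ν : Measure E} {X : ℕ → Ω → E}
    (hlaw : ∀ i, HasLaw (X i) ν P) (hindep : iIndepFun X P)
    {f : E → ℝ} (hf : Measurable f) (hint : Integrable f ν) :
    ∀ᵐ ω ∂P, Tendsto (fun n : ℕ => (∑ i ∈ Finset.range n, f (X i ω)) / n) atTop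
      (𝓝 (∫ x, f x ∂ν)) := by
  have hmap := (hlaw 0).map_eq
  have hX := (hlaw 0).aemeasurable
  have hident (i : ℕ) : IdentDistrib (X i) (X 0) P P :=
    ⟨(hlaw i).aemeasurable, hX, (hlaw i).map_eq.trans hmap.symm⟩
  have := strong_law_ae_real (fun i ω => f (X i ω)) ((hmap ▸ hint).comp_aemeasurable hX)
    (fun i j hij => (hindep.indepFun hij).comp hf hf) (fun i => (hident i).comp hf)
  rwa [← integral_map hX (f := f) hf.aestronglyMeasurable, hmap] at this

/-! ### Exact expansion of the sample central moment about `μ`. -/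

/-- Expansion of the sample central moments in powers of `X̄ₙ - c`. -/
theorem sampleCentralMoment_eq_sum (k n : ℕ) (c : ℝ) (x : ℕ → ℝ) :
    sampleCentralMoment k n x = ∑ j ∈ Finset.range (k + 1), (-(sampleMean n x - c)) ^ j *
      ((∑ i ∈ Finset.range n, (x i - c) ^ (k - j)) / n) * k.choose j := by
  have h (i : ℕ) : x i - sampleMean n x = -(sampleMean n x - c) + (x i - c) := by ring
  simp only [sampleCentralMoment, h, add_pow]
  rw [Finset.sum_comm, Finset.sum_div]
  refine Finset.sum_congr rfl fun j _ => ?_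
  rw [← Finset.sum_mul, ← Finset.mul_sum]
  ring

theorem sampleMean_sub (n : ℕ) (hn : n ≠ 0) (c : ℝ) (x : ℕ → ℝ) :
    sampleMean n x - c = (∑ i ∈ Finset.range n, (x i - c)) / n := by
  rw [sampleMean, Finset.sum_sub_distrib, sub_div]
  simp [hn]

/-- The coefficient of `(X̄ₙ - c) ^ 2` in the expansion of a sample central moment. -/
noncomputable def secondOrderCoeff (k n : ℕ) (c : ℝ) (x : ℕ → ℝ) : ℝ :=
  ∑ j ∈ Finset.range (k - 1), (-(sampleMean n x - c)) ^ j *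
      ((∑ i ∈ Finset.range n, (x i - c) ^ (k - (j + 2))) / n) * k.choose (j + 2)

/-- The influence function `x ↦ (x - μ) ^ k - μ_k - k μ_{k-1} (x - μ)` of the `k`-th central
moment. -/
noncomputable def influence (k : ℕ) (ν : Measure ℝ) (x : ℝ) : ℝ :=
  (x - ∫ y, y ∂ν) ^ k - popCentralMoment ν k
    - k * popCentralMoment ν (k - 1) * (x - ∫ y, y ∂ν)

/-- The second order term in the expansion of `n (M_{k,n} - μ_k)`. -/
noncomputable def secondOrderTerm (k n : ℕ) (ν : Measure ℝ) (x : ℕ → ℝ) : ℝ :=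
  -(k * ((√(n : ℝ))⁻¹ * ∑ i ∈ Finset.range n, (x i - ∫ y, y ∂ν))
      * ((√(n : ℝ))⁻¹ * ∑ i ∈ Finset.range n,
        ((x i - ∫ y, y ∂ν) ^ (k - 1) - popCentralMoment ν (k - 1))))
    + secondOrderCoeff k n (∫ y, y ∂ν) x
      * ((√(n : ℝ))⁻¹ * ∑ i ∈ Finset.range n, (x i - ∫ y, y ∂ν)) ^ 2

/-- In the binomial term `j = 1`, the empirical moment of order `k - 1` is split into `μ_{k-1}`,
which goes into the influence function, and its deviation, which gives the product of normalised
sums. Terms with `j ≥ 2` contain the factor `(X̄ₙ - μ) ^ 2`. -/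
theorem sampleCentralMoment_expansion (k n : ℕ) (hk : 2 ≤ k) (ν : Measure ℝ) (x : ℕ → ℝ) :
    n * (sampleCentralMoment k n x - popCentralMoment ν k) =
      ∑ i ∈ Finset.range n, influence k ν (x i) + secondOrderTerm k n ν x := by
  obtain rfl | hn := eq_or_ne n 0
  · simp [secondOrderTerm]
  obtain ⟨l, rfl⟩ := Nat.exists_eq_add_of_le' hk
  have hn' : (n : ℝ) ≠ 0 := by exact_mod_cast hn
  set c := ∫ y, y ∂ν with hc
  have hsq : ((√(n : ℝ))⁻¹) ^ 2 = (n : ℝ)⁻¹ := by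
    rw [inv_pow, Real.sq_sqrt (Nat.cast_nonneg n)]
  have hs : ∑ i ∈ Finset.range n, (x i - c) = n * (sampleMean n x - c) := by
    rw [sampleMean_sub n hn]; field_simp
  rw [sampleCentralMoment_eq_sum _ n c, Finset.sum_range_succ', Finset.sum_range_succ']
  simp only [influence, secondOrderTerm, secondOrderCoeff, ← hc, Finset.sum_sub_distrib,
    ← Finset.mul_sum, hs]
  have e1 (j : ℕ) : (-(sampleMean n x - c)) ^ (j + 1 + 1) =
    (-(sampleMean n x - c)) ^ j * (sampleMean n x - c) ^ 2 := by ring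
  have e2 : ∑ j ∈ Finset.range (l + 1), (-(sampleMean n x - c)) ^ (j + 1 + 1) *
      ((∑ i ∈ Finset.range n, (x i - c) ^ (l + 2 - (j + 1 + 1))) / n) * (l + 2).choose (j + 1 + 1)
      = (∑ j ∈ Finset.range (l + 1), (-(sampleMean n x - c)) ^ j *
      ((∑ i ∈ Finset.range n, (x i - c) ^ (l + 2 - (j + 2))) / n) * (l + 2).choose (j + 2))
        * (sampleMean n x - c) ^ 2 := by
    rw [Finset.sum_mul]
    refine Finset.sum_congr rfl fun j _ => ?_
    rw [e1]; ring
  rw [e2, show l + 2 - 1 = l + 1 by omega]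
  generalize ∑ j ∈ Finset.range (l + 1), (-(sampleMean n x - c)) ^ j *
      ((∑ i ∈ Finset.range n, (x i - c) ^ (l + 2 - (j + 2))) / n) * (l + 2).choose (j + 2) = B
  rw [mul_pow, hsq]
  have e3 (a b : ℝ) : ((l + 2 : ℕ) : ℝ) * ((√(n : ℝ))⁻¹ * a) * ((√(n : ℝ))⁻¹ * b)
    = ((l + 2 : ℕ) : ℝ) * (n : ℝ)⁻¹ * a * b := by rw [← hsq]; ring
  rw [e3]
  simp
  field_simp
  ring

theorem measurable_sampleCentralMoment (k n : ℕ) : Measurable (sampleCentralMoment k n) := by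
  unfold sampleCentralMoment sampleMean
  fun_prop

theorem measurable_secondOrderCoeff (k n : ℕ) (c : ℝ) : Measurable (secondOrderCoeff k n c) := by
  unfold secondOrderCoeff sampleMean
  fun_prop

theorem measurable_influence (k : ℕ) (ν : Measure ℝ) : Measurable (influence k ν) := by
  unfold influence
  fun_prop

theorem popCentralMoment_eq (ν : Measure ℝ) (j : ℕ) :
    popCentralMoment ν j = ∫ x, (x - ∫ y, y ∂ν) ^ j ∂ν := rfl

/-! ### Moments, and the covariance matrix as a variance form. -/

section Moments

variable {ν : Measure ℝ} [IsProbabilityMeasure ν] {k : ℕ}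

theorem integrable_sub_const_pow (hint : Integrable (fun x : ℝ => |x| ^ (2 * k)) ν)
    (c : ℝ) {m : ℕ} (hm : m ≤ 2 * k) : Integrable (fun x => (x - c) ^ m) ν := by
  obtain rfl | hm0 := eq_or_ne m 0
  · simp
  have h0 : ((2 * k : ℕ) : ℝ≥0∞) ≠ 0 := by
    exact_mod_cast (by omega : 2 * k ≠ 0)
  have h1 : MemLp (fun x : ℝ => x) (2 * k : ℕ) ν := by
    rw [← integrable_norm_rpow_iff (by fun_prop) h0 (ENNReal.natCast_ne_top _)]
    simpa only [ENNReal.toReal_natCast, Real.norm_eq_abs, Real.rpow_natCast] using hint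
  have h2 : MemLp (fun x => x - c) m ν :=
    (h1.sub (memLp_const c)).mono_exponent (by exact_mod_cast hm)
  have h3 := h2.integrable_norm_pow hm0
  exact h3.mono' (by fun_prop) (.of_forall fun x => by simp)

theorem memLp_two_sub_const_pow (hint : Integrable (fun x : ℝ => |x| ^ (2 * k)) ν)
    (c : ℝ) {m : ℕ} (hm : m ≤ k) : MemLp (fun x => (x - c) ^ m) 2 ν := by
  rw [memLp_two_iff_integrable_sq (by fun_prop)]
  simpa only [← pow_mul] using integrable_sub_const_pow hint c (m := m * 2) (by omega)

theorem memLp_two_id_sub_const (hk : 1 ≤ k) (hint : Integrable (fun x : ℝ => |x| ^ (2 * k)) ν)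
    (c : ℝ) : MemLp (fun x => x - c) 2 ν := by
  simpa using memLp_two_sub_const_pow hint c (m := 1) hk

theorem integral_sub_mean (hk : 1 ≤ k) (hint : Integrable (fun x : ℝ => |x| ^ (2 * k)) ν) :
    ∫ x, (x - ∫ y, y ∂ν) ∂ν = 0 := by
  have h : Integrable (fun x : ℝ => x) ν := by
    simpa using integrable_sub_const_pow hint 0 (m := 1) (by omega)
  rw [integral_sub h (integrable_const _)]
  simp

theorem memLp_two_influence (hk : 1 ≤ k) (hint : Integrable (fun x : ℝ => |x| ^ (2 * k)) ν) :
    MemLp (influence k ν) 2 ν :=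
  ((memLp_two_sub_const_pow hint _ le_rfl).sub (memLp_const _)).sub
    ((memLp_two_id_sub_const hk hint _).const_mul _)

theorem integral_influence (hk : 1 ≤ k) (hint : Integrable (fun x : ℝ => |x| ^ (2 * k)) ν) :
    ∫ x, influence k ν x ∂ν = 0 := by
  have h1 := integrable_sub_const_pow hint (∫ y, y ∂ν) (m := k) (by omega)
  have h2 := ((memLp_two_id_sub_const hk hint (∫ y, y ∂ν)).integrable one_le_two).const_mul
    (k * popCentralMoment ν (k - 1))
  simp only [influence]
  rw [integral_sub (by fun_prop) h2, integral_sub h1 (integrable_const _),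
    integral_const_mul, integral_sub_mean hk hint, ← popCentralMoment_eq]
  simp

/-- The centred linear combination of `x - μ` and `(x - μ) ^ (k - 1)` with coefficients `t`. -/
noncomputable def centeredCombination (k : ℕ) (ν : Measure ℝ) (t : EuclideanSpace ℝ (Fin 2))
    (x : ℝ) : ℝ :=
  t 0 * (x - ∫ y, y ∂ν) + t 1 * ((x - ∫ y, y ∂ν) ^ (k - 1) - popCentralMoment ν (k - 1))

theorem measurable_centeredCombination (k : ℕ) (ν : Measure ℝ) (t : EuclideanSpace ℝ (Fin 2)) :
    Measurable (centeredCombination k ν t) := by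
  unfold centeredCombination
  fun_prop

theorem memLp_two_centeredCombination (hk : 1 ≤ k)
    (hint : Integrable (fun x : ℝ => |x| ^ (2 * k)) ν) (t : EuclideanSpace ℝ (Fin 2)) :
    MemLp (centeredCombination k ν t) 2 ν :=
  ((memLp_two_id_sub_const hk hint _).const_mul _).add
    (((memLp_two_sub_const_pow hint _ (by omega)).sub (memLp_const _)).const_mul _)

theorem integral_centeredCombination (hk : 1 ≤ k)
    (hint : Integrable (fun x : ℝ => |x| ^ (2 * k)) ν) (t : EuclideanSpace ℝ (Fin 2)) :
    ∫ x, centeredCombination k ν t x ∂ν = 0 := by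
  have h1 := integrable_sub_const_pow hint (∫ y, y ∂ν) (m := k - 1) (by omega)
  have h2 := ((memLp_two_id_sub_const hk hint (∫ y, y ∂ν)).integrable one_le_two)
  simp only [centeredCombination]
  rw [integral_add (by fun_prop) (by fun_prop),
    integral_const_mul, integral_const_mul, integral_sub_mean hk hint,
    integral_sub h1 (integrable_const _), ← popCentralMoment_eq]
  simp

theorem variance_centeredCombination (hk : 1 ≤ k)
    (hint : Integrable (fun x : ℝ => |x| ^ (2 * k)) ν) (t : EuclideanSpace ℝ (Fin 2)) :
    Var[centeredCombination k ν t; ν] = t.ofLp ⬝ᵥ (limitCov k ν).mulVec t.ofLp := by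
  rw [variance_of_integral_eq_zero (measurable_centeredCombination k ν t).aemeasurable
    (integral_centeredCombination hk hint t)]
  have hvar : Var[id; ν] = ∫ x, (x - ∫ y, y ∂ν) ^ 2 ∂ν := by
    rw [variance_eq_integral (by fun_prop)]; rfl
  have i1 := integrable_sub_const_pow hint (∫ y, y ∂ν) (m := 2) (by omega)
  have i2 := integrable_sub_const_pow hint (∫ y, y ∂ν) (m := k) (by omega)
  have i3 := integrable_sub_const_pow hint (∫ y, y ∂ν) (m := 2 * k - 2) (by omega)
  have i4 := integrable_sub_const_pow hint (∫ y, y ∂ν) (m := k - 1) (by omega)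
  have i5 := (memLp_two_id_sub_const hk hint (∫ y, y ∂ν)).integrable one_le_two
  have e (x : ℝ) : centeredCombination k ν t x ^ 2 =
      t 0 ^ 2 * (x - ∫ y, y ∂ν) ^ 2 + 2 * t 0 * t 1 * (x - ∫ y, y ∂ν) ^ k
      + t 1 ^ 2 * (x - ∫ y, y ∂ν) ^ (2 * k - 2)
      - 2 * t 1 ^ 2 * popCentralMoment ν (k - 1) * (x - ∫ y, y ∂ν) ^ (k - 1)
      - 2 * t 0 * t 1 * popCentralMoment ν (k - 1) * (x - ∫ y, y ∂ν)
      + t 1 ^ 2 * popCentralMoment ν (k - 1) ^ 2 := by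
    obtain ⟨l, rfl⟩ := Nat.exists_eq_add_of_le' hk
    rw [centeredCombination, show 2 * (l + 1) - 2 = l * 2 by omega, Nat.add_sub_cancel, pow_mul,
      pow_succ _ l]
    ring
  simp only [e]
  rw [integral_add (by fun_prop) (by fun_prop), integral_sub (by fun_prop) (by fun_prop),
    integral_sub (by fun_prop) (by fun_prop), integral_add (by fun_prop) (by fun_prop),
    integral_add (by fun_prop) (by fun_prop)]
  simp only [integral_const_mul, integral_const, ← popCentralMoment_eq, integral_sub_mean hk hint]
  rw [popCentralMoment_eq ν 2, ← hvar]
  simp [limitCov, Matrix.mulVec, dotProduct, Fin.sum_univ_two]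
  ring

/-- The quadratic form of this matrix is the variance of `centeredCombination`. -/
theorem posSemidef_limitCov (hk : 1 ≤ k) (hint : Integrable (fun x : ℝ => |x| ^ (2 * k)) ν) :
    (limitCov k ν).PosSemidef := by
  refine Matrix.PosSemidef.of_dotProduct_mulVec_nonneg ?_ fun x => ?_
  · ext i j; fin_cases i <;> fin_cases j <;> simp [limitCov]
  · simpa using (variance_nonneg _ _).trans_eq
      (variance_centeredCombination hk hint (WithLp.toLp 2 x))

end Moments

/-- One-dimensional projections of a centred multivariate normal vector are normal. -/
theorem hasLaw_inner_multivariateGaussian {ι Ω : Type*} [Fintype ι] [DecidableEq ι]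
    {mΩ : MeasurableSpace Ω} {P : Measure Ω} {S : Matrix ι ι ℝ} (hS : S.PosSemidef)
    {W : Ω → EuclideanSpace ℝ ι} (hW : HasLaw W (multivariateGaussian 0 S) P)
    (t : EuclideanSpace ℝ ι) :
    HasLaw (fun ω => inner ℝ (W ω) t)
      (gaussianReal 0 (t.ofLp ⬝ᵥ S.mulVec t.ofLp).toNNReal) P where
  aemeasurable := by have := hW.aemeasurable; fun_prop
  map_eq := by
    have h0 : 0 ≤ t.ofLp ⬝ᵥ S.mulVec t.ofLp := by
      simpa using hS.dotProduct_mulVec_nonneg t.ofLp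
    have hm : AEMeasurable (fun ω => inner ℝ (W ω) t) P := by
      have := hW.aemeasurable; fun_prop
    have : IsProbabilityMeasure P := by
      have := hW.isProbabilityMeasure; exact this
    have := Measure.isProbabilityMeasure_map (μ := P) hm
    refine Measure.ext_of_charFun (funext fun s => ?_)
    -- Absorbing `s` into `t` turns the scalar characteristic function at `s` into the vector one at
    -- `s • t`.
    have e : (fun ω => s * inner ℝ (W ω) t) = fun ω => inner ℝ (W ω) (s • t) := by
      ext ω; rw [real_inner_smul_right]
    have h1 : charFun (P.map fun ω => inner ℝ (W ω) t) s
        = charFun (P.map fun ω => inner ℝ (W ω) (s • t)) 1 := by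
      rw [← e, charFun_map_mul_comp hm, mul_one]
    rw [h1, ← charFun_map_eq_charFun_map_inner hW.aemeasurable, hW.map_eq,
      charFun_multivariateGaussian hS, charFun_gaussianReal]
    simp [Matrix.mulVec_smul, h0]
    ring_nf

/-- The limiting quadratic form in `(W₁, W_{k-1})`. -/
noncomputable def limitVariable (k : ℕ) (ν : Measure ℝ) (w₁ wk : ℝ) : ℝ :=
  (1 / 2 : ℝ) * k * (k - 1) * popCentralMoment ν (k - 2) * w₁ ^ 2 - k * w₁ * wk

/-! ### Limit law of the second order term. -/

section Limits

variable {k : ℕ} {ν : Measure ℝ} [IsProbabilityMeasure ν]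
  {Ω : Type*} {mΩ : MeasurableSpace Ω} {P : Measure Ω} [IsProbabilityMeasure P] {X : ℕ → Ω → ℝ}
  {Ω' : Type*} {mΩ' : MeasurableSpace Ω'} {P' : Measure Ω'} [IsProbabilityMeasure P']
  {W₁ Wk : Ω' → ℝ}

/-- Bivariate central limit theorem for `x - μ` and `(x - μ) ^ (k - 1)`. -/
theorem tendstoInDistribution_centeredPowers (hk : 1 ≤ k)
    (hint : Integrable (fun x : ℝ => |x| ^ (2 * k)) ν)
    (hlaw : ∀ i, HasLaw (X i) ν P) (hindep : iIndepFun X P)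
    (hW : HasLaw (fun ω => !₂[W₁ ω, Wk ω]) (multivariateGaussian 0 (limitCov k ν)) P') :
    TendstoInDistribution
      (fun (n : ℕ) ω => !₂[(√(n : ℝ))⁻¹ * ∑ i ∈ Finset.range n, (X i ω - ∫ y, y ∂ν),
        (√(n : ℝ))⁻¹ * ∑ i ∈ Finset.range n,
          ((X i ω - ∫ y, y ∂ν) ^ (k - 1) - popCentralMoment ν (k - 1))])
      atTop (fun ω => !₂[W₁ ω, Wk ω]) (fun _ => P) P' := by
  have hX (i : ℕ) : AEMeasurable (X i) P := (hlaw i).aemeasurable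
  refine tendstoInDistribution_of_forall_inner (fun n => ?_) hW.aemeasurable fun t => ?_
  · refine (PiLp.continuous_toLp 2 _).measurable.comp_aemeasurable (aemeasurable_pi_lambda _ ?_)
    intro i
    fin_cases i
    · exact (Finset.aemeasurable_fun_sum _ fun i _ => by fun_prop).const_mul _
    · exact (Finset.aemeasurable_fun_sum _ fun i _ => by fun_prop).const_mul _
  · have hZ := hasLaw_inner_multivariateGaussian (posSemidef_limitCov hk hint) hW t
    rw [← variance_centeredCombination hk hint t] at hZ
    convert tendstoInDistribution_inv_sqrt_mul_sum_comp hlaw hindep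
      (measurable_centeredCombination k ν t) (memLp_two_centeredCombination hk hint t)
      (integral_centeredCombination hk hint t) hZ using 3 with n ω
    simp only [PiLp.inner_apply, Fin.sum_univ_two, centeredCombination, Finset.sum_add_distrib,
      ← Finset.mul_sum]
    simp
    ring

theorem tendstoInMeasure_secondOrderCoeff (hk : 2 ≤ k)
    (hint : Integrable (fun x : ℝ => |x| ^ (2 * k)) ν)
    (hlaw : ∀ i, HasLaw (X i) ν P) (hindep : iIndepFun X P) :
    TendstoInMeasure P (fun (n : ℕ) ω => secondOrderCoeff k n (∫ y, y ∂ν) (fun i => X i ω)) atTop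
      (fun _ => popCentralMoment ν (k - 2) * k.choose 2) := by
  have hX : AEMeasurable (fun ω i => X i ω) P :=
    aemeasurable_pi_lambda _ fun i => (hlaw i).aemeasurable
  refine tendstoInMeasure_of_tendsto_ae (fun n =>
    ((measurable_secondOrderCoeff k n _).comp_aemeasurable hX).aestronglyMeasurable) ?_
  have h (j : ℕ) : ∀ᵐ ω ∂P, Tendsto
      (fun n : ℕ => (∑ i ∈ Finset.range n, (X i ω - ∫ y, y ∂ν) ^ (k - (j + 2))) / n) atTop
      (𝓝 (popCentralMoment ν (k - (j + 2)))) :=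
    ae_tendsto_sum_comp_div hlaw hindep (f := fun x => (x - ∫ y, y ∂ν) ^ (k - (j + 2)))
      (by fun_prop) (integrable_sub_const_pow hint _ (by omega))
  have hm := ae_tendsto_sum_comp_div hlaw hindep (f := fun x => x - ∫ y, y ∂ν)
      (by fun_prop) ((memLp_two_id_sub_const (by omega) hint _).integrable one_le_two)
  rw [integral_sub_mean (by omega) hint] at hm
  filter_upwards [ae_all_iff.2 h, hm] with ω hω hmω
  have hA : Tendsto (fun n : ℕ => -(sampleMean n (fun i => X i ω) - ∫ y, y ∂ν)) atTop (𝓝 0) := by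
    rw [← neg_zero]
    refine (hmω.congr' ?_).neg
    filter_upwards [eventually_ne_atTop 0] with n hn
    rw [sampleMean_sub n hn]
  have := tendsto_finsetSum (Finset.range (k - 1)) fun j _ =>
    ((hA.pow j).mul (hω j)).mul_const (k.choose (j + 2) : ℝ)
  -- Since `X̄ₙ - μ → 0`, only the term `j = 0` survives.
  rw [Finset.sum_eq_single 0 (fun j _ hj => by simp [hj]) (fun h0 => by simp at h0; omega),
    pow_zero, one_mul, zero_add] at this
  exact this

theorem tendstoInDistribution_secondOrderTerm (hk : 2 ≤ k)
    (hint : Integrable (fun x : ℝ => |x| ^ (2 * k)) ν)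
    (hlaw : ∀ i, HasLaw (X i) ν P) (hindep : iIndepFun X P)
    (hW : HasLaw (fun ω => !₂[W₁ ω, Wk ω]) (multivariateGaussian 0 (limitCov k ν)) P') :
    TendstoInDistribution (fun (n : ℕ) ω => secondOrderTerm k n ν (fun i => X i ω)) atTop
      (fun ω => limitVariable k ν (W₁ ω) (Wk ω)) (fun _ => P) P' := by
  have hX : AEMeasurable (fun ω i => X i ω) P :=
    aemeasurable_pi_lambda _ fun i => (hlaw i).aemeasurable
  -- Slutsky: `p.1` carries the two normalised sums, `p.2` the coefficient with constant limit.
  have hg : Continuous fun p : EuclideanSpace ℝ (Fin 2) × ℝ =>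
    -(k * p.1 0 * p.1 1) + p.2 * p.1 0 ^ 2 := by fun_prop
  have := (tendstoInDistribution_centeredPowers (by omega) hint hlaw hindep
    hW).continuous_comp_prodMk_of_tendstoInMeasure_const hg
    (tendstoInMeasure_secondOrderCoeff hk hint hlaw hindep)
    (fun n => (measurable_secondOrderCoeff k n _).comp_aemeasurable hX)
  have e : (fun ω => limitVariable k ν (W₁ ω) (Wk ω)) = fun ω =>
      -(k * W₁ ω * Wk ω) + popCentralMoment ν (k - 2) * k.choose 2 * W₁ ω ^ 2 := by
    ext ω
    rw [limitVariable, Nat.cast_choose_two]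
    ring
  rw [e]
  exact this

end Limits

/-! ### Consequence of singularity, and conclusion. -/

/-- For a singular distribution the influence function of the central moment vanishes. -/
theorem IsSingularOfOrder.influence_ae_eq_zero {k : ℕ} (hk : 2 ≤ k) {ν : Measure ℝ}
    [IsProbabilityMeasure ν] (hν : IsSingularOfOrder k ν) : ∀ᵐ x ∂ν, influence k ν x = 0 := by
  have hk1 : 1 ≤ k := by omega
  have hint := hν.integrable
  set Q := Measure.infinitePi (fun _ : ℕ => ν)
  have hlaw (i : ℕ) : HasLaw (fun x : ℕ → ℝ => x i) ν Q :=
    (measurePreserving_eval_infinitePi (fun _ : ℕ => ν) i).hasLaw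
  have hindep : iIndepFun (fun i (x : ℕ → ℝ) => x i) Q :=
    iIndepFun_infinitePi (X := fun _ x => x) fun _ => measurable_id
  -- Any realisation of the normal vector would do; here it is the identity on its own law.
  have hW : HasLaw (fun w : EuclideanSpace ℝ (Fin 2) => !₂[w 0, w 1])
      (multivariateGaussian 0 (limitCov k ν)) (multivariateGaussian 0 (limitCov k ν)) := by
    have e : (fun w : EuclideanSpace ℝ (Fin 2) => !₂[w 0, w 1]) = id := by
      ext w i; fin_cases i <;> rfl
    rw [e]
    exact HasLaw.id
  have hS := tendstoInDistribution_secondOrderTerm hk hint hlaw hindep hW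
  have hsqrt : Tendsto (fun n : ℕ => (√(n : ℝ))⁻¹) atTop (𝓝 0) :=
    tendsto_inv_atTop_zero.comp (Real.tendsto_sqrt_atTop.comp tendsto_natCast_atTop_atTop)
  -- Convergence in distribution of the second order term makes its quotient by `√n` vanish in the
  -- limit.
  have h1 := hS.continuous_comp_prodMk_of_tendstoInMeasure_const
    (g := fun p : ℝ × ℝ => -(p.2 * p.1)) (by fun_prop)
    (Y := fun (n : ℕ) _ => (√(n : ℝ))⁻¹) (c := 0)
    (tendstoInMeasure_of_tendsto_ae (fun n => by fun_prop) (.of_forall fun _ => hsqrt))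
    (fun n => by fun_prop)
  have h2 := h1.add_of_tendstoInMeasure_const hν.tendsto fun n =>
    (((measurable_sampleCentralMoment k n).sub_const _).const_mul _).aemeasurable
  have h3 := tendstoInDistribution_inv_sqrt_mul_sum_comp hlaw hindep (measurable_influence k ν)
    (memLp_two_influence hk1 hint) (integral_influence hk1 hint) HasLaw.id
  have h4 := h2.congr (Y := fun (n : ℕ) x => (√(n : ℝ))⁻¹ * ∑ i ∈ Finset.range n,
    influence k ν (x i)) (fun n => .of_forall fun x => ?_) EventuallyEq.rfl
  · have h5 := tendstoInDistribution_unique _ h3 h4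
    have h6 := congrArg (fun m : Measure ℝ => Var[id; m]) h5
    simp at h6
    have h7 := ae_eq_integral_of_variance_eq_zero (memLp_two_influence hk1 hint)
      h6
    rwa [integral_influence hk1 hint] at h7
  · have h := sampleCentralMoment_expansion k n hk ν x
    obtain rfl | hn := eq_or_ne n 0
    · simp
    have hn' : 0 < (n : ℝ) := by positivity
    have e : √(n : ℝ) = (√(n : ℝ))⁻¹ * n := by
      field_simp
      exact Real.sq_sqrt hn'.le
    simp only [Pi.add_apply]
    rw [e, mul_assoc, h, ← e]
    ring

theorem mainTheorem2 (k : ℕ) (hk : 2 ≤ k)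
    (ν : Measure ℝ) [IsProbabilityMeasure ν] (hν : IsSingularOfOrder k ν)
    {Ω : Type*} [MeasurableSpace Ω] (P : Measure Ω) [IsProbabilityMeasure P]
    (X : ℕ → Ω → ℝ) (hlaw : ∀ i, HasLaw (X i) ν P) (hindep : iIndepFun X P)
    {Ω' : Type*} [MeasurableSpace Ω'] (P' : Measure Ω') [IsProbabilityMeasure P']
    (W₁ Wk : Ω' → ℝ)
    (hW : HasLaw (fun ω => !₂[W₁ ω, Wk ω]) (multivariateGaussian 0 (limitCov k ν)) P') :
    (limitCov k ν).PosSemidef ∧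
    TendstoInDistribution
      (fun (n : ℕ) (ω : Ω) =>
        (n : ℝ) * (sampleCentralMoment k n (fun i => X i ω) - popCentralMoment ν k))
      atTop
      (fun ω => (1 / 2 : ℝ) * k * (k - 1) * popCentralMoment ν (k - 2) * W₁ ω ^ 2
        - k * W₁ ω * Wk ω)
      (fun _ => P) P' := by
  refine ⟨posSemidef_limitCov (by omega) hν.integrable, ?_⟩
  have hg (i : ℕ) : ∀ᵐ ω ∂P, influence k ν (X i ω) = 0 := by
    refine ae_of_ae_map (hlaw i).aemeasurable (p := fun x => influence k ν x = 0) ?_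
    rw [(hlaw i).map_eq]
    exact hν.influence_ae_eq_zero hk
  refine (tendstoInDistribution_secondOrderTerm hk hν.integrable hlaw hindep hW).congr
    (fun n => ?_) EventuallyEq.rfl
  filter_upwards [ae_all_iff.2 hg] with ω hω
  rw [sampleCentralMoment_expansion k n hk ν, Finset.sum_eq_zero fun i _ => hω i, zero_add]
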